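/- Let $m\ge 1$ be an integer and let $1<p<\infty$, $1<\tau<\infty$. For a real-valued Lebesgue measurable function $f$ on $\mathbb{R}^m$ that is $2\pi$-periodic in each variable, put $$\|f\|_{p,\tau}=\Bigl(\int_0^1 (f^*(t))^{\tau}\,t^{\frac{\tau}{p}-1}\,dt\Bigr)^{1/\tau},$$ where $f^*$ is the non-increasing rearrangement of the function $|f(2\pi x)|$, $x\in[0,1)^m$. Let $\Lambda_{p,\tau}$ be the set of all such functions $f$ with $\|f\|_{p,\tau}<\infty$ and $\int_0^1 f(2\pi x)\,dx_j=0$ for $j=1,\dots,m$ (for almost all values of the remaining variables) that have a lacunary Fourier series $$f(x)\sim\sum_{\nu\in\mathbb{Z}_+^m}\lambda_\nu\prod_{j=1}^m\cos 2^{\nu_j}x_j,\qquad \lambda_\nu\in\mathbb{R},$$ where $\mathbb{Z}_+=\{0,1,2,\dots\}$. Then there are constants $C_1,C_2,C_3>0$, depending only on $m,p,\tau$, such that the following hold for every $f\in\Lambda_{p,\tau}$ with coefficients $\lambda=(\lambda_\nu)$. 1. For all $1<p<\infty$ and $1<\tau<\infty$, $$\|f\|_{p,\tau}\le C_1\Bigl(\sum_{\nu\in\mathbb{Z}_+^m}|\lambda_\nu|^2\Bigr)^{1/2}.$$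 2. If $1<p\le 2$ and $1<\tau\le 2$, or if $2<p<\infty$ and $1<\tau<\infty$, then $$\Bigl(\sum_{\nu\in\mathbb{Z}_+^m}|\lambda_\nu|^2\Bigr)^{1/2}\le C_2\,\|f\|_{p,\tau}.$$ 3. If $1<p\le 2$ and $2<\tau<\infty$, then $$\Bigl(\sum_{\nu\in\mathbb{Z}_+^m}|\lambda_\nu|^\tau\Bigr)^{1/\tau}\le C_3\,\|f\|_{p,\tau}.$$ (A divergent series has the value $+\infty$; in particular the series in parts 2 and 3 converge.) -/

import Mathlib

open MeasureTheory
open scoped NNReal ENNReal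

noncomputable section

namespace LorentzLacunary

/-- The unit cube `[0, 1)^m`. -/
def unitCube (m : ℕ) : Set (Fin m → ℝ) :=
  Set.univ.pi fun _ => Set.Ico (0 : ℝ) 1

/-- The function `x ↦ f (2π x)`. -/
def rescale {m : ℕ} (f : (Fin m → ℝ) → ℝ) (x : Fin m → ℝ) : ℝ :=
  f fun j => 2 * Real.pi * x j

/-- The non-increasing rearrangement `f^*(t)`, `t > 0`, of the function `|f (2π x)|` on `[0, 1)^m`:
the infimum of all `y ≥ 0` such that `|f (2π x)| > y` holds on a set of measure at most `t`. -/
def rearrangement {m : ℕ} (f : (Fin m → ℝ) → ℝ) (t : ℝ) : ℝ≥0∞ :=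
  sInf {y : ℝ≥0∞ | volume {x | x ∈ unitCube m ∧ y < ‖rescale f x‖ₑ} ≤ ENNReal.ofReal t}

/-- The Lorentz quantity `(∫_0^1 f^*(t)^τ t^(τ/p - 1) dt)^(1/τ)`, as an extended number. -/
def lorentzNorm {m : ℕ} (p τ : ℝ) (f : (Fin m → ℝ) → ℝ) : ℝ≥0∞ :=
  (∫⁻ t in Set.Ioo (0 : ℝ) 1,
    rearrangement f t ^ τ * ENNReal.ofReal (t ^ (τ / p - 1))) ^ (1 / τ)

/-- The Lorentz space `L_{p,τ}(𝕋^m)`: real-valued Lebesgue measurable functions, `2π`-periodic in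
each variable, with finite Lorentz quantity.  (For real-valued functions, almost everywhere
equal to a Borel function is the same as Lebesgue measurable.) -/
structure MemLorentz {m : ℕ} (p τ : ℝ) (f : (Fin m → ℝ) → ℝ) : Prop where
  measurable : AEMeasurable f volume
  periodic : ∀ (j : Fin m) (x : Fin m → ℝ), f (x + Pi.single j (2 * Real.pi)) = f x
  finite : lorentzNorm p τ f < ∞

/-- The subspace of those `f ∈ L_{p,τ}(𝕋^m)` with mean value zero in each variable `x_j`,
for almost all values of the other variables. -/
structure MemLorentzZero {m : ℕ} (p τ : ℝ) (f : (Fin m → ℝ) → ℝ) : Prop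
    extends MemLorentz p τ f where
  mean_zero : ∀ j : Fin m, ∀ᵐ x : Fin m → ℝ ∂volume,
    ∫ t in (0 : ℝ)..1, rescale f (Function.update x j t) = 0

/-- The Fourier coefficient `a_n(f) = ∫_{[0,1)^m} f(2π x) e^{-i⟨n, 2π x⟩} dx`. -/
def coeff {m : ℕ} (f : (Fin m → ℝ) → ℝ) (n : Fin m → ℤ) : ℂ :=
  ∫ x in unitCube m,
    (rescale f x : ℂ) * Complex.exp (-Complex.I * ∑ j, (n j : ℂ) * (2 * Real.pi * x j : ℝ))

/-- `∑_ν lam_ν ∏_j cos (2^{ν_j} x_j)` is the Fourier series of `f`.  As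
`∏_j cos (2^{ν_j} x_j)` is the sum of `2^{-m} e^{i⟨n, x⟩}` over all `n` with `|n_j| = 2^{ν_j}`
for every `j`, this says that `a_n(f) = 2^{-m} lam_ν` for these `n`, and that `a_n(f) = 0` for
all `n` which do not occur for any `ν`. -/
structure HasLacunarySeries {m : ℕ} (f : (Fin m → ℝ) → ℝ) (lam : (Fin m → ℕ) → ℝ) : Prop where
  coeff_eq : ∀ (ν : Fin m → ℕ) (n : Fin m → ℤ), (∀ j, |n j| = 2 ^ ν j) →
    coeff f n = (lam ν : ℂ) / 2 ^ m
  coeff_eq_zero : ∀ n : Fin m → ℤ, (¬ ∃ ν : Fin m → ℕ, ∀ j, |n j| = 2 ^ ν j) →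
    coeff f n = 0

/-- The class `Λ_{p,τ}` of functions with a lacunary Fourier series. -/
def lacunaryClass (m : ℕ) (p τ : ℝ) : Set ((Fin m → ℝ) → ℝ) :=
  {f | MemLorentzZero p τ f ∧ ∃ lam : (Fin m → ℕ) → ℝ, HasLacunarySeries f lam}

/-- `(∑_ν |lam_ν|^q)^(1/q)`, as an extended number (infinite if the series diverges). -/
def seqNorm {m : ℕ} (q : ℝ) (lam : (Fin m → ℕ) → ℝ) : ℝ≥0∞ :=
  (∑' ν, ‖lam ν‖ₑ ^ q) ^ (1 / q)

end LorentzLacunary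

end

noncomputable section

namespace LorentzLacunary

/-! On lacunary functions all Lebesgue norms with finite exponent greater than 1 are comparable to
the `ℓ²` norm of the coefficients. A Lorentz quantity with first index `p > 1` lies between the
`L^r` norms, `r < p`, and the `L^q` norms, `q > p`, so it is comparable to the `ℓ²` norm too.

The analytic core is a Khintchine inequality in `L^{2k}`. In one variable, Riesz products
(`integral_riesz_product`) make the functions `cos (2π 2^n x)` behave like independent signs in
exponential moments, which gives subgaussian bounds and hence `integral_sum_cosMode_pow_le`.
Minkowski's inequality and induction on `m` carry it to products (`lintegral_sum_prod_pow_le`).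

For the upper estimate, square summable coefficients make the series converge in `L^{2k}`.
Uniqueness of Fourier coefficients identifies its sum with `f` (`HasLacunarySeries.eLpNorm_le`), and
`lorentzNorm_le` with `2k > p` concludes. For the lower one, `f` is tested against partial sums of
its own series, with Hölder for the pair `r`, `2k` (`HasLacunarySeries.tsum_sq_le`). For large `k`
one has `r < p`, so `eLpNorm_rescale_le` applies. The `ℓ^τ` estimate follows from `ℓ² ⊆ ℓ^τ` for `τ
> 2` (`seqNorm_le_seqNorm_two`). -/

/-! ### Riesz products and the Khintchine inequality in one variable. -/

/-- The function `x ↦ cos (2π 2^n x)`. -/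
def cosMode (n : ℕ) (x : ℝ) : ℝ := Real.cos (2 * Real.pi * 2 ^ n * x)

@[fun_prop]
theorem continuous_cosMode (n : ℕ) : Continuous (cosMode n) := by
  unfold cosMode; fun_prop

theorem abs_cosMode_le_one (n : ℕ) (x : ℝ) : |cosMode n x| ≤ 1 := Real.abs_cos_le_one _

theorem cosMode_add_one (n : ℕ) (x : ℝ) : cosMode n (x + 1) = cosMode n x := by
  unfold cosMode
  rw [show 2 * Real.pi * 2 ^ n * (x + 1) = 2 * Real.pi * 2 ^ n * x
    + ((2 ^ n : ℕ) : ℝ) * (2 * Real.pi) by push_cast; ring]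
  exact Real.cos_add_nat_mul_two_pi _ _

theorem cosMode_succ (n : ℕ) (x : ℝ) : cosMode (n + 1) x = cosMode n (2 * x) := by
  unfold cosMode
  congr 1
  ring

theorem cosMode_zero_add_half (x : ℝ) : cosMode 0 (x + 1 / 2) = -cosMode 0 x := by
  unfold cosMode
  rw [← Real.cos_add_pi]
  congr 1
  ring

/-- The integral of a Riesz product over a period is the product of the constant terms. -/
theorem integral_riesz_product (N : ℕ) : ∀ c d : ℕ → ℝ,
    ∫ x in (0 : ℝ)..1, ∏ n ∈ Finset.range N, (c n + d n * cosMode n x) =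
      ∏ n ∈ Finset.range N, c n := by
  induction N with
  | zero => intro c d; simp
  | succ N ih =>
    intro c d
    -- The factors with `n ≥ 1` form a Riesz product with shifted coefficients, evaluated at `2 *
    -- x`.
    set Q : ℝ → ℝ := fun x => ∏ n ∈ Finset.range N, (c (n + 1) + d (n + 1) * cosMode n x) with hQ
    have hQc : Continuous Q := by
      rw [hQ]; fun_prop
    have hQp : Function.Periodic Q 1 := fun x => by simp only [hQ, cosMode_add_one]
    have h1 : ∫ x in (0 : ℝ)..1, Q (2 * x) = ∏ n ∈ Finset.range N, c (n + 1) := by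
      rw [intervalIntegral.integral_comp_mul_left _ two_ne_zero]
      have h := hQp.intervalIntegral_add_eq 0 1
      rw [zero_add] at h
      norm_num at h ⊢
      rw [← intervalIntegral.integral_add_adjacent_intervals (b := 1)
        (hQc.intervalIntegrable _ _) (hQc.intervalIntegrable _ _), ← h,
        ih (fun n => c (n + 1)) (fun n => d (n + 1))]
      ring
    -- A shift by one half fixes `Q (2 * x)` and changes the sign of `cosMode 0`, so the integral
    -- equals its own negative.
    have h2 : ∫ x in (0 : ℝ)..1, Q (2 * x) * cosMode 0 x = 0 := by
      set F : ℝ → ℝ := fun x => Q (2 * x) * cosMode 0 x with hF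
      have hFp : Function.Periodic F 1 := fun x => by
        simp only [hF, cosMode_add_one]
        rw [show 2 * (x + 1) = 2 * x + 1 + 1 by ring, hQp, hQp]
      have h := hFp.intervalIntegral_add_eq 0 (1 / 2)
      have h' : ∫ x in (0 : ℝ)..1, F (x + 1 / 2) = -∫ x in (0 : ℝ)..1, F x := by
        rw [← intervalIntegral.integral_neg]
        congr 1
        ext x
        simp only [hF, cosMode_zero_add_half]
        rw [show 2 * (x + 1 / 2) = 2 * x + 1 by ring, hQp]
        ring
      rw [intervalIntegral.integral_comp_add_right] at h'
      rw [zero_add, add_comm (1 / 2 : ℝ) 1] at h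
      rw [zero_add] at h'
      linarith
    have h3 : ∀ x, ∏ n ∈ Finset.range (N + 1), (c n + d n * cosMode n x) =
        c 0 * Q (2 * x) + d 0 * (Q (2 * x) * cosMode 0 x) := fun x => by
      rw [Finset.prod_range_succ']
      simp only [hQ, cosMode_succ]
      ring
    simp_rw [h3]
    rw [intervalIntegral.integral_add, intervalIntegral.integral_const_mul,
      intervalIntegral.integral_const_mul, h1, h2, Finset.prod_range_succ']
    · ring
    · exact Continuous.intervalIntegrable (by fun_prop) _ _
    · exact Continuous.intervalIntegrable (by fun_prop) _ _

/-- Convexity gives `exp (a t) ≤ cosh a + t sinh a` for `|t| ≤ 1`. This bounds the exponential by a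
Riesz product, whose mean is `∏ cosh (a n)`. -/
theorem integral_exp_sum_cosMode_le (N : ℕ) (a : ℕ → ℝ) :
    ∫ x in (0 : ℝ)..1, Real.exp (∑ n ∈ Finset.range N, a n * cosMode n x) ≤
      Real.exp ((∑ n ∈ Finset.range N, a n ^ 2) / 2) := by
  calc _ ≤ ∫ x in (0 : ℝ)..1, ∏ n ∈ Finset.range N,
        (Real.cosh (a n) + Real.sinh (a n) * cosMode n x) := by
        refine intervalIntegral.integral_mono_on zero_le_one
          (Continuous.intervalIntegrable (by fun_prop) _ _)
          (Continuous.intervalIntegrable (by fun_prop) _ _) fun x _ => ?_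
        rw [Real.exp_sum]
        refine Finset.prod_le_prod (fun _ _ => (Real.exp_pos _).le) fun n _ => ?_
        have := Real.exp_mul_le_cosh_add_mul_sinh (abs_cosMode_le_one n x) (a n)
        rw [mul_comm (a n)] at *
        linarith
    _ = ∏ n ∈ Finset.range N, Real.cosh (a n) := integral_riesz_product _ _ _
    _ ≤ ∏ n ∈ Finset.range N, Real.exp (a n ^ 2 / 2) :=
        Finset.prod_le_prod (fun _ _ => (Real.cosh_pos _).le)
          fun n _ => Real.cosh_le_exp_half_sq _
    _ = _ := by rw [← Real.exp_sum, Finset.sum_div]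

/-- The constant in the Khintchine inequality for the exponent `2k`. -/
def khintchineConst (k : ℕ) : ℝ := (2 * k).factorial * (2 * Real.exp (1 / 2))

theorem khintchineConst_pos (k : ℕ) : 0 < khintchineConst k := by
  unfold khintchineConst; positivity

/-- The Khintchine inequality for the lacunary sequence `2^n`. -/
theorem integral_sum_cosMode_pow_le (N : ℕ) {k : ℕ} (hk : k ≠ 0) (a : ℕ → ℝ) :
    ∫ x in (0 : ℝ)..1, (∑ n ∈ Finset.range N, a n * cosMode n x) ^ (2 * k) ≤
      khintchineConst k * (∑ n ∈ Finset.range N, a n ^ 2) ^ k := by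
  -- For unit square sum, `y ^ (2k) ≤ (2k)! (exp y + exp (-y))`, and each exponential has mean at
  -- most `exp (1/2)`. The general case follows by homogeneity.
  have key : ∀ b : ℕ → ℝ, ∑ n ∈ Finset.range N, b n ^ 2 = 1 →
      ∫ x in (0 : ℝ)..1, (∑ n ∈ Finset.range N, b n * cosMode n x) ^ (2 * k) ≤
        khintchineConst k := by
    intro b hb
    have e1 := integral_exp_sum_cosMode_le N b
    have e2 := integral_exp_sum_cosMode_le N (fun n => - b n)
    simp only [neg_mul, Finset.sum_neg_distrib, neg_sq] at e2
    rw [hb] at e1 e2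
    calc _ ≤ ∫ x in (0 : ℝ)..1, ((2 * k).factorial : ℝ) *
          (Real.exp (∑ n ∈ Finset.range N, b n * cosMode n x) +
            Real.exp (-∑ n ∈ Finset.range N, b n * cosMode n x)) := by
          refine intervalIntegral.integral_mono_on zero_le_one
            (Continuous.intervalIntegrable (by fun_prop) _ _)
            (Continuous.intervalIntegrable (by fun_prop) _ _) fun x _ => ?_
          set y := ∑ n ∈ Finset.range N, b n * cosMode n x
          have h := Real.pow_div_factorial_le_exp |y| (abs_nonneg y) (2 * k)
          rw [(even_two_mul k).pow_abs, div_le_iff₀' (by positivity)] at h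
          refine h.trans ?_
          gcongr
          rcases abs_cases y with ⟨h, -⟩ | ⟨h, -⟩ <;> rw [h]
          · linarith [Real.exp_pos (-y)]
          · linarith [Real.exp_pos y]
      _ ≤ _ := by
          rw [intervalIntegral.integral_const_mul, intervalIntegral.integral_add
            (Continuous.intervalIntegrable (by fun_prop) _ _)
            (Continuous.intervalIntegrable (by fun_prop) _ _), khintchineConst]
          gcongr
          linarith
  set A := ∑ n ∈ Finset.range N, a n ^ 2 with hA
  have hA0 : 0 ≤ A := Finset.sum_nonneg fun _ _ => sq_nonneg _
  rcases hA0.eq_or_lt with h0 | hpos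
  · have hz : ∀ n ∈ Finset.range N, a n = 0 := fun n hn => by
      have := (Finset.sum_eq_zero_iff_of_nonneg fun _ _ => sq_nonneg _).1 h0.symm n hn
      exact pow_eq_zero_iff two_ne_zero |>.1 this
    have hz' : ∀ x, ∑ n ∈ Finset.range N, a n * cosMode n x = 0 := fun x =>
      Finset.sum_eq_zero fun n hn => by rw [hz n hn, zero_mul]
    simp [hz', ← h0, hk]
  · have h := key (fun n => a n / √A) (by
      simp only [div_pow, Real.sq_sqrt hA0]
      rw [← Finset.sum_div, ← hA, div_self hpos.ne'])
    have e : ∀ x, (∑ n ∈ Finset.range N, a n * cosMode n x) ^ (2 * k) =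
        A ^ k * (∑ n ∈ Finset.range N, a n / √A * cosMode n x) ^ (2 * k) := fun x => by
      have : ∑ n ∈ Finset.range N, a n / √A * cosMode n x =
          (∑ n ∈ Finset.range N, a n * cosMode n x) / √A := by
        rw [Finset.sum_div]; exact Finset.sum_congr rfl fun _ _ => by ring
      rw [this, div_pow, pow_mul (√A), Real.sq_sqrt hA0]
      field_simp
    simp_rw [e]
    rw [intervalIntegral.integral_const_mul, mul_comm]
    gcongr

/-! ### Passage of the Khintchine inequality to product systems. -/

/-- This is Minkowski's inequality in `L^k`, stated with `k`-th powers in order to avoid roots. -/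
theorem lintegral_sum_pow_le {Ω ι : Type*} [MeasurableSpace Ω] (μ : Measure Ω) {k : ℕ} (hk : k ≠ 0)
    (s : Finset ι) (F : ι → Ω → ℝ≥0∞) (hF : ∀ i ∈ s, Measurable (F i)) (B : ι → ℝ≥0∞)
    (hB : ∀ i ∈ s, ∫⁻ x, F i x ^ k ∂μ ≤ B i ^ k) :
    ∫⁻ x, (∑ i ∈ s, F i x) ^ k ∂μ ≤ (∑ i ∈ s, B i) ^ k := by
  classical
  have hk1 : (1 : ℝ) ≤ k := by exact_mod_cast Nat.one_le_iff_ne_zero.2 hk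
  have hk0 : (k : ℝ) ≠ 0 := by positivity
  have root : ∀ a b : ℝ≥0∞, a ≤ b ^ k ↔ a ^ (1 / (k : ℝ)) ≤ b := fun a b => by
    rw [one_div, ENNReal.rpow_inv_le_iff (by positivity), ENNReal.rpow_natCast]
  rw [root]
  induction s using Finset.induction_on with
  | empty => simp [hk, Nat.pos_of_ne_zero hk]
  | insert i s hi ih =>
    simp only [Finset.sum_insert hi]
    have hFs : Measurable fun x => ∑ i ∈ s, F i x :=
      Finset.measurable_fun_sum _ fun j hj => hF j (Finset.mem_insert_of_mem hj)
    have h := ENNReal.lintegral_Lp_add_le (μ := μ) (p := k)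
      (hF i (Finset.mem_insert_self _ _)).aemeasurable hFs.aemeasurable hk1
    simp only [ENNReal.rpow_natCast, Pi.add_apply] at h
    refine h.trans (add_le_add ((root _ _).1 (hB i (Finset.mem_insert_self _ _))) ?_)
    exact ih (fun j hj => hF j (Finset.mem_insert_of_mem hj))
      (fun j hj => hB j (Finset.mem_insert_of_mem hj))

/-- A Khintchine inequality for a finite system of functions passes to the `m`-fold products. -/
theorem lintegral_sum_prod_pow_le {Ω κ : Type*} [MeasurableSpace Ω] [Fintype κ]
    (μ : Measure Ω) [IsProbabilityMeasure μ] {k : ℕ} (hk : k ≠ 0) (φ : κ → Ω → ℝ)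
    (hφ : ∀ i, Measurable (φ i)) (K : ℝ≥0∞)
    (hK : ∀ a : κ → ℝ, ∫⁻ x, ‖∑ i, a i * φ i x‖ₑ ^ (2 * k) ∂μ ≤ K ^ k * (∑ i, ‖a i‖ₑ ^ 2) ^ k)
    (m : ℕ) : ∀ c : (Fin m → κ) → ℝ,
    ∫⁻ x, ‖∑ ν, c ν * ∏ j, φ (ν j) (x j)‖ₑ ^ (2 * k) ∂(Measure.pi fun _ : Fin m => μ) ≤
      (K ^ m) ^ k * (∑ ν, ‖c ν‖ₑ ^ 2) ^ k := by
  induction m with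
  | zero => intro c; simp [pow_mul]
  | succ m ih =>
    intro c
    have hm : Measurable fun x : Fin (m + 1) → Ω =>
        ‖∑ ν, c ν * ∏ j, φ (ν j) (x j)‖ₑ ^ (2 * k) := by fun_prop
    have split : ∀ x : Fin (m + 1) → Ω, ∑ ν, c ν * ∏ j, φ (ν j) (x j) =
        ∑ i, (∑ ν : Fin m → κ, c (Fin.cons i ν) * ∏ j, φ (ν j) (Fin.tail x j)) * φ i (x 0) := by
      intro x
      rw [← (Fin.consEquiv fun _ : Fin (m + 1) => κ).sum_comp, Fintype.sum_prod_type]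
      refine Finset.sum_congr rfl fun i _ => ?_
      rw [Finset.sum_mul]
      refine Finset.sum_congr rfl fun ν _ => ?_
      simp only [Fin.consEquiv, Equiv.coe_fn_mk, Fin.prod_univ_succ, Fin.cons_zero, Fin.cons_succ,
        Fin.tail]
      ring
    have mp := (measurePreserving_piFinSuccAbove (fun _ : Fin (m + 1) => μ) 0).symm
    rw [← mp.lintegral_comp hm, lintegral_prod_symm' (fun z => ‖∑ ν, c ν * ∏ j, φ (ν j)
      ((MeasurableEquiv.piFinSuccAbove (fun _ => Ω) 0).symm z j)‖ₑ ^ (2 * k))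
      (hm.comp (MeasurableEquiv.measurable _))]
    set G : κ → (Fin m → Ω) → ℝ := fun i y =>
      ∑ ν : Fin m → κ, c (Fin.cons i ν) * ∏ j, φ (ν j) (y j) with hG
    have hGm : ∀ i, Measurable (G i) := fun i => by simp only [hG]; fun_prop
    -- For frozen `y` the one-variable inequality applies to the first coordinate. Minkowski for the
    -- functions `‖G i y‖ₑ ^ 2` then reduces the rest to the induction hypothesis for each `G i`.
    calc _ = ∫⁻ y, ∫⁻ x, ‖∑ i, G i y * φ i x‖ₑ ^ (2 * k) ∂μ ∂(Measure.pi fun _ : Fin m => μ) := by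
          refine lintegral_congr fun y => lintegral_congr fun x => ?_
          simp only [split]
          rfl
      _ ≤ ∫⁻ y, K ^ k * (∑ i, ‖G i y‖ₑ ^ 2) ^ k ∂(Measure.pi fun _ : Fin m => μ) :=
          lintegral_mono fun y => hK fun i => G i y
      _ = K ^ k * ∫⁻ y, (∑ i, ‖G i y‖ₑ ^ 2) ^ k ∂(Measure.pi fun _ : Fin m => μ) :=
          lintegral_const_mul _ (by fun_prop)
      _ ≤ K ^ k * (∑ i, K ^ m * ∑ ν : Fin m → κ, ‖c (Fin.cons i ν)‖ₑ ^ 2) ^ k := by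
          gcongr
          refine lintegral_sum_pow_le _ hk _ _ (fun i _ => by fun_prop) _ fun i _ => ?_
          simp only [← pow_mul]
          rw [mul_pow]
          exact ih fun ν => c (Fin.cons i ν)
      _ = _ := by
          rw [← Finset.mul_sum, ← (Fin.consEquiv fun _ : Fin (m + 1) => κ).sum_comp,
            Fintype.sum_prod_type, ← mul_pow, ← mul_pow, pow_succ' K, mul_assoc]
          rfl

/-! ### The Khintchine inequality on the cube. -/

/-- Lebesgue measure on the unit cube. -/
abbrev cubeMeasure (m : ℕ) : Measure (Fin m → ℝ) := volume.restrict (unitCube m)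

theorem measurableSet_unitCube (m : ℕ) : MeasurableSet (unitCube m) :=
  MeasurableSet.univ_pi fun _ => measurableSet_Ico

theorem cubeMeasure_eq_pi (m : ℕ) :
    cubeMeasure m = Measure.pi fun _ => volume.restrict (Set.Ico (0 : ℝ) 1) :=
  Measure.restrict_pi_pi _ _

instance isProbabilityMeasure_restrict_Ico :
    IsProbabilityMeasure (volume.restrict (Set.Ico (0 : ℝ) 1)) := ⟨by simp⟩

instance isProbabilityMeasure_cubeMeasure (m : ℕ) : IsProbabilityMeasure (cubeMeasure m) := by
  rw [cubeMeasure_eq_pi]; infer_instance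

/-- The function `x ↦ ∏_j cos (2π 2^{ν_j} x_j)`. -/
def cosProd {m : ℕ} (ν : Fin m → ℕ) (x : Fin m → ℝ) : ℝ := ∏ j, cosMode (ν j) (x j)

@[fun_prop]
theorem continuous_cosProd {m : ℕ} (ν : Fin m → ℕ) : Continuous (cosProd ν) := by
  unfold cosProd; fun_prop

theorem abs_cosProd_le_one {m : ℕ} (ν : Fin m → ℕ) (x : Fin m → ℝ) : |cosProd ν x| ≤ 1 := by
  rw [cosProd, Finset.abs_prod]
  exact Finset.prod_le_one (fun _ _ => abs_nonneg _) fun _ _ => abs_cosMode_le_one _ _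

theorem lintegral_sum_cosMode_pow_le (N : ℕ) {k : ℕ} (hk : k ≠ 0) (a : Fin N → ℝ) :
    ∫⁻ x in Set.Ico (0 : ℝ) 1, ‖∑ i, a i * cosMode i x‖ₑ ^ (2 * k) ≤
      ENNReal.ofReal (khintchineConst k) * (∑ i, ‖a i‖ₑ ^ 2) ^ k := by
  set b : ℕ → ℝ := fun n => if h : n < N then a ⟨n, h⟩ else 0 with hb
  have hab : ∀ i : Fin N, a i = b i := fun i => by simp [hb]
  have h := integral_sum_cosMode_pow_le N hk b
  have e1 : ∀ x, ∑ i, a i * cosMode i x = ∑ n ∈ Finset.range N, b n * cosMode n x := fun x => by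
    simp only [hab]; exact Fin.sum_univ_eq_sum_range (fun n => b n * cosMode n x) N
  have e2 : ∑ i, ‖a i‖ₑ ^ 2 = ENNReal.ofReal (∑ n ∈ Finset.range N, b n ^ 2) := by
    rw [ENNReal.ofReal_sum_of_nonneg fun _ _ => sq_nonneg _,
      ← Fin.sum_univ_eq_sum_range (fun n => ENNReal.ofReal (b n ^ 2))]
    refine Finset.sum_congr rfl fun i _ => ?_
    rw [hab, Real.enorm_eq_ofReal_abs, ← ENNReal.ofReal_pow (abs_nonneg _), sq_abs]
  have e3 : ∀ x, ‖∑ i, a i * cosMode i x‖ₑ ^ (2 * k) =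
      ENNReal.ofReal ((∑ n ∈ Finset.range N, b n * cosMode n x) ^ (2 * k)) := fun x => by
    rw [e1, Real.enorm_eq_ofReal_abs, ← ENNReal.ofReal_pow (abs_nonneg _),
      (even_two_mul k).pow_abs]
  simp_rw [e3]
  rw [← ofReal_integral_eq_lintegral_ofReal, e2, ← ENNReal.ofReal_pow,
    ← ENNReal.ofReal_mul (khintchineConst_pos k).le]
  · refine ENNReal.ofReal_le_ofReal (le_trans (le_of_eq ?_) h)
    rw [intervalIntegral.integral_of_le zero_le_one, integral_Ico_eq_integral_Ioc]
  · exact Finset.sum_nonneg fun _ _ => sq_nonneg _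
  · exact (Continuous.integrableOn_Icc (by fun_prop)).mono_set Set.Ico_subset_Icc_self
  · exact Filter.Eventually.of_forall fun x => (even_two_mul k).pow_nonneg _

/-- The constant in the Khintchine inequality for the `m`-fold lacunary system. -/
def cubeConst (m k : ℕ) : ℝ≥0 := (Real.toNNReal (khintchineConst k) ^ (1 / (k : ℝ))) ^ m

theorem cubeConst_pos (m k : ℕ) : 0 < cubeConst m k :=
  pow_pos (NNReal.rpow_pos (Real.toNNReal_pos.2 (khintchineConst_pos k))) _

theorem lintegral_sum_cosProd_pow_le {m k : ℕ} (hk : k ≠ 0) (s : Finset (Fin m → ℕ))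
    (c : (Fin m → ℕ) → ℝ) :
    ∫⁻ x, ‖∑ ν ∈ s, c ν * cosProd ν x‖ₑ ^ (2 * k) ∂cubeMeasure m ≤
      (cubeConst m k * ∑ ν ∈ s, ‖c ν‖ₑ ^ 2) ^ k := by
  classical
  -- The finite index set is enclosed in a box `(Fin N)^m` and the coefficients are extended by
  -- zero, since the product inequality needs a full box.
  obtain ⟨N, hN⟩ : ∃ N : ℕ, ∀ ν ∈ s, ∀ j, ν j < N := by
    refine ⟨(s.sup fun ν => Finset.univ.sup ν) + 1, fun ν hν j => Nat.lt_succ_of_le ?_⟩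
    exact (Finset.le_sup (Finset.mem_univ j)).trans
      (Finset.le_sup (f := fun ν : Fin m → ℕ => Finset.univ.sup ν) hν)
  set c' : (Fin m → ℕ) → ℝ := fun ν => if ν ∈ s then c ν else 0 with hc'
  have conv : ∀ {R : Type} [AddCommMonoid R] (g : (Fin m → ℕ) → R), (∀ ν ∉ s, g ν = 0) →
      ∑ ν ∈ s, g ν = ∑ ν : Fin m → Fin N, g fun j => ν j := by
    intro R _ g hg
    refine Eq.trans ?_ (Finset.sum_map Finset.univ
      ⟨fun (ν : Fin m → Fin N) (j : Fin m) => (ν j : ℕ), fun a b h => by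
        funext j; exact Fin.ext (congrFun h j)⟩ g)
    refine Finset.sum_subset (fun ν hν => ?_) fun ν _ h => hg ν h
    exact Finset.mem_map.2 ⟨fun j => ⟨ν j, hN ν hν j⟩, Finset.mem_univ _, rfl⟩
  have e1 : ∀ x, ∑ ν ∈ s, c ν * cosProd ν x =
      ∑ ν : Fin m → Fin N, c' (fun j => ν j) * ∏ j, cosMode (ν j) (x j) := fun x => by
    refine Eq.trans ?_ (conv (fun ν => c' ν * cosProd ν x) fun ν hν => by simp [hc', hν])
    exact Finset.sum_congr rfl fun ν hν => by simp [hc', hν]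
  have e2 : ∑ ν ∈ s, ‖c ν‖ₑ ^ 2 = ∑ ν : Fin m → Fin N, ‖c' (fun j => ν j)‖ₑ ^ 2 := by
    refine Eq.trans ?_ (conv (fun ν => ‖c' ν‖ₑ ^ 2) fun ν hν => by simp [hc', hν])
    exact Finset.sum_congr rfl fun ν hν => by simp [hc', hν]
  have hk0 : (k : ℝ) ≠ 0 := by exact_mod_cast hk
  simp_rw [e1, e2, cubeMeasure_eq_pi]
  rw [mul_pow]
  have h := lintegral_sum_prod_pow_le (volume.restrict (Set.Ico (0 : ℝ) 1)) hk
    (fun i : Fin N => cosMode i) (fun i => (continuous_cosMode i).measurable)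
    ((Real.toNNReal (khintchineConst k) ^ (1 / (k : ℝ)) : ℝ≥0) : ℝ≥0∞)
    (fun a => (lintegral_sum_cosMode_pow_le N hk a).trans (by
      gcongr
      rw [← ENNReal.coe_pow, ← NNReal.rpow_natCast, ← NNReal.rpow_mul, one_div,
        inv_mul_cancel₀ hk0, NNReal.rpow_one]
      rfl)) m (fun ν => c' fun j => ν j)
  rwa [cubeConst, ENNReal.coe_pow]

theorem eLpNorm_sum_cosProd_le {m k : ℕ} (hk : k ≠ 0) (s : Finset (Fin m → ℕ))
    (c : (Fin m → ℕ) → ℝ) :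
    eLpNorm (fun x => ∑ ν ∈ s, c ν * cosProd ν x) (2 * k : ℕ) (cubeMeasure m) ≤
      (cubeConst m k * ∑ ν ∈ s, ‖c ν‖ₑ ^ 2) ^ (1 / 2 : ℝ) := by
  have hk0 : (k : ℝ) ≠ 0 := by exact_mod_cast hk
  rw [eLpNorm_eq_lintegral_rpow_enorm_toReal (by simpa using hk)
    (ENNReal.natCast_ne_top _)]
  simp only [ENNReal.toReal_natCast, ENNReal.rpow_natCast]
  refine (ENNReal.rpow_le_rpow (lintegral_sum_cosProd_pow_le hk s c) (by positivity)).trans_eq ?_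
  rw [← ENNReal.rpow_natCast, ← ENNReal.rpow_mul]
  congr 1
  push_cast
  field_simp

/-! ### Exponentials and Fourier coefficients of the lacunary products. -/

/-- The function `x ↦ e^{-i n 2π x}`. -/
def expMode (n : ℤ) (x : ℝ) : ℂ := Complex.exp (-Complex.I * ((n : ℂ) * (2 * Real.pi * x : ℝ)))

/-- The function `x ↦ e^{-i⟨n, 2π x⟩}`. -/
def expProd {m : ℕ} (n : Fin m → ℤ) (x : Fin m → ℝ) : ℂ :=
  Complex.exp (-Complex.I * ∑ j, (n j : ℂ) * (2 * Real.pi * x j : ℝ))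

@[fun_prop]
theorem continuous_expMode (n : ℤ) : Continuous (expMode n) := by
  unfold expMode; fun_prop

@[fun_prop]
theorem continuous_expProd {m : ℕ} (n : Fin m → ℤ) : Continuous (expProd n) := by
  unfold expProd; fun_prop

theorem expProd_eq_prod {m : ℕ} (n : Fin m → ℤ) (x : Fin m → ℝ) :
    expProd n x = ∏ j, expMode (n j) (x j) := by
  simp only [expProd, expMode, Finset.mul_sum, Complex.exp_sum]

theorem norm_expProd {m : ℕ} (n : Fin m → ℤ) (x : Fin m → ℝ) : ‖expProd n x‖ = 1 := by
  have : -Complex.I * ∑ j, (n j : ℂ) * (2 * Real.pi * x j : ℝ) =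
      ((-∑ j, (n j : ℝ) * (2 * Real.pi * x j) : ℝ) : ℂ) * Complex.I := by
    push_cast; ring
  rw [expProd, this, Complex.norm_exp_ofReal_mul_I]

theorem coeff_eq_integral_expProd {m : ℕ} (f : (Fin m → ℝ) → ℝ) (n : Fin m → ℤ) :
    coeff f n = ∫ x, (rescale f x : ℂ) * expProd n x ∂cubeMeasure m := rfl

theorem ofReal_cosMode (a : ℕ) (x : ℝ) :
    (cosMode a x : ℂ) = ∑ l ∈ ({2 ^ a, -2 ^ a} : Finset ℤ), expMode l x / 2 := by
  have h : (2 : ℤ) ^ a ≠ -2 ^ a := by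
    have : (0 : ℤ) < 2 ^ a := by positivity
    omega
  rw [Finset.sum_pair h, ← add_div, cosMode, Complex.ofReal_cos, Complex.cos, expMode, expMode,
    add_comm]
  congr 3 <;> · push_cast; ring_nf

/-- The frequencies `n` with `|n_j| = 2^{ν_j}`. -/
def frequencies {m : ℕ} (ν : Fin m → ℕ) : Finset (Fin m → ℤ) :=
  Fintype.piFinset fun j => ({2 ^ ν j, -2 ^ ν j} : Finset ℤ)

theorem mem_frequencies {m : ℕ} (ν : Fin m → ℕ) (n : Fin m → ℤ) :
    n ∈ frequencies ν ↔ ∀ j, |n j| = 2 ^ ν j := by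
  rw [frequencies, Fintype.mem_piFinset]
  refine forall_congr' fun j => ?_
  rw [abs_eq (by positivity)]
  simp

theorem card_frequencies {m : ℕ} (ν : Fin m → ℕ) : (frequencies ν).card = 2 ^ m := by
  rw [frequencies, Fintype.card_piFinset]
  have h : ∀ a : ℕ, (2 : ℤ) ^ a ≠ -2 ^ a := fun a => by
    have : (0 : ℤ) < 2 ^ a := by positivity
    omega
  simp [Finset.card_pair (h _)]

theorem ofReal_cosProd {m : ℕ} (ν : Fin m → ℕ) (x : Fin m → ℝ) :
    (cosProd ν x : ℂ) = ∑ n ∈ frequencies ν, expProd n x / 2 ^ m := by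
  rw [cosProd, Complex.ofReal_prod]
  simp_rw [ofReal_cosMode]
  rw [Finset.prod_univ_sum]
  refine Finset.sum_congr rfl fun n _ => ?_
  rw [expProd_eq_prod, Finset.prod_div_distrib]
  simp

theorem integral_expMode (n : ℤ) :
    ∫ x in Set.Ico (0 : ℝ) 1, expMode n x = if n = 0 then 1 else 0 := by
  split_ifs with h
  · simp [h, expMode]
  · rw [integral_Ico_eq_integral_Ioc, ← intervalIntegral.integral_of_le zero_le_one]
    have e : ∀ x : ℝ, expMode n x = Complex.exp ((-Complex.I * n * (2 * Real.pi)) * x) :=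
      fun x => by unfold expMode; push_cast; ring_nf
    simp_rw [e]
    rw [integral_exp_mul_complex]
    · have : Complex.exp (-Complex.I * n * (2 * Real.pi) * (1 : ℝ)) = 1 :=
        Complex.exp_eq_one_iff.2 ⟨-n, by push_cast; ring⟩
      rw [this]; simp
    · simp [h, Real.pi_ne_zero]

theorem integral_cosMode_mul_expMode (a : ℕ) (n : ℤ) :
    ∫ x in Set.Ico (0 : ℝ) 1, (cosMode a x : ℂ) * expMode n x =
      if |n| = 2 ^ a then 1 / 2 else 0 := by
  have h : (0 : ℤ) < 2 ^ a := by positivity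
  have h' : (2 : ℤ) ^ a ≠ -2 ^ a := by omega
  have e : ∀ x, (cosMode a x : ℂ) * expMode n x =
      expMode (2 ^ a + n) x / 2 + expMode (-2 ^ a + n) x / 2 := fun x => by
    have (k : ℤ) : expMode (k + n) x = expMode k x * expMode n x := by
      simp only [expMode, ← Complex.exp_add]; congr 1; push_cast; ring
    rw [ofReal_cosMode, Finset.sum_pair h', this, this]; ring
  have hint : ∀ k : ℤ, Integrable (fun x => expMode k x / 2)
      (volume.restrict (Set.Ico (0 : ℝ) 1)) := fun k =>
    (Continuous.integrableOn_Icc (by fun_prop)).mono_set Set.Ico_subset_Icc_self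
  simp_rw [e]
  rw [integral_add (hint _) (hint _), integral_div, integral_div, integral_expMode,
    integral_expMode]
  simp only [abs_eq h.le]
  rcases eq_or_ne n (2 ^ a) with h1 | h1
  · rw [if_neg (by omega), if_pos (by omega), if_pos (Or.inl h1)]; simp
  rcases eq_or_ne n (-2 ^ a) with h2 | h2
  · rw [if_pos (by omega), if_neg (by omega), if_pos (Or.inr h2)]; simp
  · rw [if_neg (by omega), if_neg (by omega), if_neg (by tauto)]; simp

theorem integral_cosProd_mul_expProd {m : ℕ} (ν : Fin m → ℕ) (n : Fin m → ℤ) :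
    ∫ x, (cosProd ν x : ℂ) * expProd n x ∂cubeMeasure m =
      if ∀ j, |n j| = 2 ^ ν j then 1 / 2 ^ m else 0 := by
  have e : ∀ x : Fin m → ℝ, (cosProd ν x : ℂ) * expProd n x =
      ∏ j, ((cosMode (ν j) (x j) : ℂ) * expMode (n j) (x j)) := fun x => by
    rw [Finset.prod_mul_distrib, expProd_eq_prod, cosProd, Complex.ofReal_prod]
  simp_rw [e]
  rw [cubeMeasure_eq_pi, integral_fintype_prod_eq_prod
    (f := fun j (y : ℝ) => (cosMode (ν j) y : ℂ) * expMode (n j) y)]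
  simp_rw [integral_cosMode_mul_expMode]
  split_ifs with h
  · simp [h]
  · push Not at h
    obtain ⟨j, hj⟩ := h
    exact Finset.prod_eq_zero (Finset.mem_univ j) (if_neg hj)

theorem integrable_mul_expProd {m : ℕ} {g : (Fin m → ℝ) → ℝ} (hg : Integrable g (cubeMeasure m))
    (n : Fin m → ℤ) : Integrable (fun x => (g x : ℂ) * expProd n x) (cubeMeasure m) :=
  hg.ofReal.mul_bdd (c := 1) (continuous_expProd n).aestronglyMeasurable
    (Filter.Eventually.of_forall fun x => (norm_expProd n x).le)

/-- Pairing a function with a lacunary Fourier series and `∏_j cos (2π 2^{ν_j} x_j)`. -/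
theorem HasLacunarySeries.integral_mul_cosProd {m : ℕ} {f : (Fin m → ℝ) → ℝ}
    {lam : (Fin m → ℕ) → ℝ} (hf : HasLacunarySeries f lam)
    (hi : Integrable (rescale f) (cubeMeasure m)) (ν : Fin m → ℕ) :
    ∫ x, rescale f x * cosProd ν x ∂cubeMeasure m = lam ν / 2 ^ m := by
  have : ((∫ x, rescale f x * cosProd ν x ∂cubeMeasure m : ℝ) : ℂ) = lam ν / 2 ^ m := by
    rw [← integral_complex_ofReal]
    simp_rw [Complex.ofReal_mul, ofReal_cosProd, Finset.mul_sum, ← mul_div_assoc]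
    rw [integral_finsetSum _ fun n _ => (integrable_mul_expProd hi n).div_const _]
    simp_rw [integral_div, ← coeff_eq_integral_expProd]
    rw [Finset.sum_congr rfl fun n hn => by
      rw [hf.coeff_eq ν n ((mem_frequencies ν n).1 hn)], Finset.sum_const, card_frequencies]
    simp only [nsmul_eq_mul]
    push_cast
    field_simp
  exact_mod_cast this

/-! ### Uniqueness of Fourier coefficients for integrable functions. -/

theorem measurable_torus_mk (m : ℕ) :
    Measurable fun (x : Fin m → ℝ) (i : Fin m) => (x i : UnitAddCircle) :=
  measurable_pi_lambda _ fun i => AddCircle.measurable_mk'.comp (measurable_pi_apply i)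

theorem continuous_torus_mk (m : ℕ) :
    Continuous fun (x : Fin m → ℝ) (i : Fin m) => (x i : UnitAddCircle) :=
  continuous_pi fun i => (AddCircle.continuous_mk' 1).comp (continuous_apply i)

/-- The sign of `n` flips because `expProd` carries the conjugated exponential of the coefficient
integral. -/
theorem mFourier_mk {m : ℕ} (n : Fin m → ℤ) (x : Fin m → ℝ) :
    UnitAddTorus.mFourier n (fun i => (x i : UnitAddCircle)) = expProd (-n) x := by
  rw [expProd_eq_prod, UnitAddTorus.mFourier, ContinuousMap.coe_mk]
  refine Finset.prod_congr rfl fun j _ => ?_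
  rw [fourier_coe_apply, expMode]
  congr 1
  push_cast [Pi.neg_apply]
  ring

/-- Integration against `D` is a functional on continuous functions bounded by the `L¹` norm of `D`.
Its kernel is closed and contains all characters, whose span is dense. -/
theorem integral_mul_continuousMap_eq_zero {m : ℕ} {D : (Fin m → ℝ) → ℝ}
    (hD : Integrable D (cubeMeasure m))
    (h0 : ∀ n, ∫ x, (D x : ℂ) * expProd n x ∂cubeMeasure m = 0) (h : C(UnitAddTorus (Fin m), ℂ)) :
    ∫ x, (D x : ℂ) * h (fun i => (x i : UnitAddCircle)) ∂cubeMeasure m = 0 := by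
  have hint : ∀ h : C(UnitAddTorus (Fin m), ℂ), Integrable
      (fun x => (D x : ℂ) * h (fun i => (x i : UnitAddCircle))) (cubeMeasure m) := fun h =>
    hD.ofReal.mul_bdd (c := ‖h‖)
      (h.continuous.comp (continuous_torus_mk m)).aestronglyMeasurable
      (Filter.Eventually.of_forall fun x => h.norm_coe_le_norm _)
  let L : C(UnitAddTorus (Fin m), ℂ) →ₗ[ℂ] ℂ :=
    { toFun := fun h => ∫ x, (D x : ℂ) * h (fun i => (x i : UnitAddCircle)) ∂cubeMeasure m
      map_add' := fun g h => by
        simp only [ContinuousMap.add_apply, mul_add]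
        exact integral_add (hint g) (hint h)
      map_smul' := fun c h => by
        simp only [ContinuousMap.smul_apply, smul_eq_mul, RingHom.id_apply]
        rw [← integral_const_mul]
        congr 1; ext x; ring }
  let L' : C(UnitAddTorus (Fin m), ℂ) →L[ℂ] ℂ := L.mkContinuous (∫ x, ‖D x‖ ∂cubeMeasure m)
    fun h => by
      refine (norm_integral_le_integral_norm _).trans ?_
      rw [← integral_mul_const]
      refine integral_mono (hint h).norm (hD.norm.mul_const _) fun x => ?_
      simp only [norm_mul, Complex.norm_real]
      gcongr
      exact h.norm_coe_le_norm _
  have hle : (Submodule.span ℂ (Set.range <| UnitAddTorus.mFourier (d := Fin m))).topologicalClosure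
      ≤ LinearMap.ker L'.toLinearMap := by
    refine Submodule.topologicalClosure_minimal _ (Submodule.span_le.2 ?_) L'.isClosed_ker
    rintro _ ⟨n, rfl⟩
    change ∫ x, (D x : ℂ) * UnitAddTorus.mFourier n (fun i => (x i : UnitAddCircle))
      ∂cubeMeasure m = 0
    simp_rw [mFourier_mk]
    exact h0 _
  rw [UnitAddTorus.span_mFourier_closure_eq_top] at hle
  exact hle (Submodule.mem_top (x := h))

/-- An integrable function on the cube whose Fourier coefficients vanish is zero. -/
theorem ae_eq_zero_of_integral_mul_expProd {m : ℕ} {D : (Fin m → ℝ) → ℝ}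
    (hD : Integrable D (cubeMeasure m))
    (h0 : ∀ n, ∫ x, (D x : ℂ) * expProd n x ∂cubeMeasure m = 0) : D =ᵐ[cubeMeasure m] 0 := by
  set mk : (Fin m → ℝ) → UnitAddTorus (Fin m) := fun x i => (x i : UnitAddCircle) with hmk
  have hmkm : Measurable mk := measurable_torus_mk m
  set inv : UnitAddTorus (Fin m) → (Fin m → ℝ) := fun z i => (AddCircle.equivIco 1 0 (z i)).1
    with hinv
  have hinvm : Measurable inv := measurable_pi_lambda _ fun i =>
    measurable_subtype_coe.comp
      ((AddCircle.measurableEquivIco 1 0).measurable.comp (measurable_pi_apply i))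
  have hli : ∀ x ∈ unitCube m, inv (mk x) = x := fun x hx => by
    funext i
    have hxi := hx i (Set.mem_univ i)
    have hxi' : x i ∈ Set.Ico (0 : ℝ) (0 + 1) := by simpa using hxi
    exact congrArg Subtype.val (AddCircle.equivIco_coe_eq hxi')
  have hmeas : AEMeasurable (fun x => ENNReal.ofReal (D x)) (cubeMeasure m) :=
    hD.aemeasurable.ennreal_ofReal
  have hmeas' : AEMeasurable (fun x => ENNReal.ofReal (-D x)) (cubeMeasure m) :=
    hD.neg.aemeasurable.ennreal_ofReal
  have hfin : IsFiniteMeasure ((cubeMeasure m).withDensity fun x => ENNReal.ofReal (D x)) :=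
    isFiniteMeasure_withDensity_ofReal hD.2
  have hfin' : IsFiniteMeasure ((cubeMeasure m).withDensity fun x => ENNReal.ofReal (-D x)) :=
    isFiniteMeasure_withDensity_ofReal hD.neg.2
  -- The positive and negative parts of `D` define finite measures on the torus with the same
  -- integrals of continuous functions, hence equal ones. The section `inv` then brings this
  -- equality back to the cube.
  have hmap : ((cubeMeasure m).withDensity fun x => ENNReal.ofReal (D x)).map mk =
      ((cubeMeasure m).withDensity fun x => ENNReal.ofReal (-D x)).map mk := by
    refine ext_of_forall_integral_eq_of_IsFiniteMeasure fun g => ?_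
    have hg : Continuous fun x => g (mk x) := g.continuous.comp (continuous_torus_mk m)
    have hint : ∀ F : (Fin m → ℝ) → ℝ, Integrable F (cubeMeasure m) →
        Integrable (fun x => (ENNReal.ofReal (F x)).toReal • g (mk x)) (cubeMeasure m) :=
      fun F hF => by
        simp only [ENNReal.toReal_ofReal', smul_eq_mul]
        exact hF.pos_part.mul_bdd (c := ‖g‖) hg.aestronglyMeasurable
          (Filter.Eventually.of_forall fun x => g.norm_coe_le_norm _)
    rw [integral_map hmkm.aemeasurable g.continuous.measurable.aestronglyMeasurable,
      integral_map hmkm.aemeasurable g.continuous.measurable.aestronglyMeasurable,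
      integral_withDensity_eq_integral_toReal_smul₀ hmeas (by simp),
      integral_withDensity_eq_integral_toReal_smul₀ hmeas' (by simp), ← sub_eq_zero,
      ← integral_sub (hint D hD) (hint (fun x => -D x) hD.neg)]
    have h := integral_mul_continuousMap_eq_zero hD h0
      ⟨fun z => (g z : ℂ), Complex.continuous_ofReal.comp g.continuous⟩
    have h' : ((∫ x, D x * g (mk x) ∂cubeMeasure m : ℝ) : ℂ) = 0 := by
      rw [← integral_complex_ofReal, ← h]
      congr 1; ext x; simp [hmk]
    rw [← Complex.ofReal_eq_zero.1 h']
    congr 1; ext x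
    simp only [ENNReal.toReal_ofReal', smul_eq_mul, ← sub_mul]
    congr 1
    rcases le_total 0 (D x) with hx | hx
    · simp [hx]
    · simp [hx]
  have hback : ∀ F : (Fin m → ℝ) → ℝ≥0∞,
      (((cubeMeasure m).withDensity F).map mk).map inv = (cubeMeasure m).withDensity F := fun F => by
    rw [Measure.map_map hinvm hmkm]
    refine (Measure.map_congr (g := id) ?_).trans Measure.map_id
    refine (withDensity_absolutelyContinuous _ F).ae_le ?_
    filter_upwards [ae_restrict_mem (measurableSet_unitCube m)] with x hx using hli x hx
  have heq : (cubeMeasure m).withDensity (fun x => ENNReal.ofReal (D x)) =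
      (cubeMeasure m).withDensity fun x => ENNReal.ofReal (-D x) := by
    rw [← hback, hmap, hback]
  have hae := (withDensity_eq_iff_of_sigmaFinite hmeas hmeas').1 heq
  filter_upwards [hae] with x hx
  rcases lt_trichotomy (D x) 0 with h | h | h
  · rw [ENNReal.ofReal_of_nonpos h.le, eq_comm, ENNReal.ofReal_eq_zero] at hx
    linarith
  · exact h
  · rw [ENNReal.ofReal_of_nonpos (neg_nonpos.2 h.le), ENNReal.ofReal_eq_zero] at hx
    linarith

/-! ### Lebesgue norms of functions with lacunary series. -/

/-- A function whose lacunary Fourier coefficients are square summable belongs to `L^{2k}`. -/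
theorem HasLacunarySeries.eLpNorm_le {m k : ℕ} (hk : k ≠ 0) {f : (Fin m → ℝ) → ℝ}
    {lam : (Fin m → ℕ) → ℝ} (hf : HasLacunarySeries f lam)
    (hi : Integrable (rescale f) (cubeMeasure m)) (hlam : ∑' ν, ‖lam ν‖ₑ ^ 2 ≠ ∞) :
    eLpNorm (rescale f) (2 * k : ℕ) (cubeMeasure m) ≤
      (cubeConst m k * ∑' ν, ‖lam ν‖ₑ ^ 2) ^ (1 / 2 : ℝ) := by
  set q : ℝ≥0∞ := ((2 * k : ℕ) : ℝ≥0∞) with hq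
  have hq1 : 1 ≤ q := by
    rw [hq, Nat.one_le_cast]
    omega
  have : Fact (1 ≤ q) := ⟨hq1⟩
  have hmem : ∀ ν, MemLp (fun x => lam ν * cosProd ν x) q (cubeMeasure m) := fun ν =>
    MemLp.of_bound (by fun_prop) |lam ν| (Filter.Eventually.of_forall fun x => by
      rw [norm_mul, Real.norm_eq_abs, Real.norm_eq_abs]
      exact mul_le_of_le_one_right (abs_nonneg _) (abs_cosProd_le_one ν x))
  set u : (Fin m → ℕ) → Lp ℝ q (cubeMeasure m) := fun ν => (hmem ν).toLp with hu
  have hsum : ∀ s : Finset (Fin m → ℕ), (∑ ν ∈ s, u ν : Lp ℝ q (cubeMeasure m)) =ᵐ[cubeMeasure m]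
      fun x => ∑ ν ∈ s, lam ν * cosProd ν x := fun s => by
    have h : ∀ᵐ x ∂cubeMeasure m, ∀ ν, u ν x = lam ν * cosProd ν x :=
      ae_all_iff.2 fun ν => (hmem ν).coeFn_toLp
    filter_upwards [Lp.coeFn_finsetSum s u, h] with x h1 h2
    rw [h1, Finset.sum_apply]
    exact Finset.sum_congr rfl fun ν _ => h2 ν
  have hbound : ∀ s : Finset (Fin m → ℕ), ‖∑ ν ∈ s, u ν‖ₑ ≤
      (cubeConst m k * ∑ ν ∈ s, ‖lam ν‖ₑ ^ 2) ^ (1 / 2 : ℝ) := fun s => by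
    rw [Lp.enorm_def, eLpNorm_congr_ae (hsum s)]
    exact eLpNorm_sum_cosProd_le hk s lam
  have hbound' : ∀ s : Finset (Fin m → ℕ),
      ‖∑ ν ∈ s, u ν‖ ^ 2 ≤ cubeConst m k * ∑ ν ∈ s, ‖lam ν‖ ^ 2 := fun s => by
    have h := ENNReal.rpow_le_rpow (hbound s) (zero_le_two (α := ℝ))
    rw [← ENNReal.rpow_mul, one_div, inv_mul_cancel₀ two_ne_zero, ENNReal.rpow_one,
      ENNReal.rpow_two] at h
    simp only [enorm_eq_nnnorm] at h
    have h' : ‖∑ ν ∈ s, u ν‖₊ ^ 2 ≤ cubeConst m k * ∑ ν ∈ s, ‖lam ν‖₊ ^ 2 := by exact_mod_cast h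
    simpa using NNReal.coe_le_coe.2 h'
  have hsq : Summable fun ν => ‖lam ν‖ ^ 2 := by
    have : Summable fun ν => ‖lam ν‖₊ ^ 2 := by
      rw [← ENNReal.tsum_coe_ne_top_iff_summable]
      exact_mod_cast hlam
    simpa using NNReal.summable_coe.2 this
  -- By `hbound'`, the Cauchy criterion for the square sums is one for the series in `L^q`.
  have hsummable : Summable u := by
    rw [summable_iff_vanishing_norm] at hsq ⊢
    intro ε hε
    have hK : (0 : ℝ) < cubeConst m k := cubeConst_pos m k
    obtain ⟨s, hs⟩ := hsq (ε ^ 2 / cubeConst m k) (by positivity)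
    refine ⟨s, fun t ht => lt_of_pow_lt_pow_left₀ 2 hε.le ((hbound' t).trans_lt ?_)⟩
    have := (le_abs_self _).trans_lt (hs t ht)
    rwa [lt_div_iff₀' hK] at this
  obtain ⟨g, hg⟩ := hsummable
  have hgnorm : eLpNorm g q (cubeMeasure m) ≤
      (cubeConst m k * ∑' ν, ‖lam ν‖ₑ ^ 2) ^ (1 / 2 : ℝ) := by
    rw [← Lp.enorm_def]
    refine le_of_tendsto ((continuous_enorm.tendsto g).comp hg)
      (Filter.Eventually.of_forall fun s => (hbound s).trans ?_)
    gcongr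
    exact ENNReal.sum_le_tsum s
  have hgi : Integrable g (cubeMeasure m) := (Lp.memLp g).integrable hq1
  have hcoeff : ∀ n, ∫ x, (g x : ℂ) * expProd n x ∂cubeMeasure m = coeff f n := by
    intro n
    have hcm : ∀ ν, Integrable (fun x => ((lam ν * cosProd ν x : ℝ) : ℂ) * expProd n x)
        (cubeMeasure m) := fun ν => integrable_mul_expProd ((hmem ν).integrable hq1) n
    -- On a probability space `L^q` convergence implies `L¹` convergence, so Fourier coefficients of
    -- partial sums converge to those of `g`.
    have h1 : HasSum (fun ν => ∫ x, ((lam ν * cosProd ν x : ℝ) : ℂ) * expProd n x ∂cubeMeasure m)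
        (∫ x, (g x : ℂ) * expProd n x ∂cubeMeasure m) := by
      have hint : ∀ s : Finset (Fin m → ℕ), Integrable (fun x =>
          ∑ ν ∈ s, ((lam ν * cosProd ν x : ℝ) : ℂ) * expProd n x) (cubeMeasure m) := fun s =>
        integrable_finsetSum s fun ν _ => hcm ν
      have ht := tendsto_integral_of_L1' (l := Filter.atTop)
        (F := fun (s : Finset (Fin m → ℕ)) x =>
          ∑ ν ∈ s, ((lam ν * cosProd ν x : ℝ) : ℂ) * expProd n x)
        (fun x => (g x : ℂ) * expProd n x) (integrable_mul_expProd hgi n).aestronglyMeasurable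
        (Filter.Eventually.of_forall hint) ?_
      · refine ht.congr fun s => ?_
        exact integral_finsetSum s fun ν _ => hcm ν
      · have h0 := (Lp.tendsto_Lp_iff_tendsto_eLpNorm' _ _).1 hg
        refine tendsto_of_tendsto_of_tendsto_of_le_of_le tendsto_const_nhds h0
          (fun _ => zero_le) fun s => ?_
        calc _ = eLpNorm ((∑ ν ∈ s, u ν : Lp ℝ q (cubeMeasure m)) - g : (Fin m → ℝ) → ℝ) 1
              (cubeMeasure m) := by
              refine eLpNorm_congr_norm_ae ?_
              filter_upwards [hsum s] with x hx
              simp only [Pi.sub_apply]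
              rw [hx, ← Finset.sum_mul, ← sub_mul, norm_mul, norm_expProd, mul_one,
                ← Complex.ofReal_sum, ← Complex.ofReal_sub, Complex.norm_real]
          _ ≤ _ := eLpNorm_le_eLpNorm_of_exponent_le hq1
              ((Lp.aestronglyMeasurable _).sub (Lp.aestronglyMeasurable _))
    have h2 : ∀ ν, ∫ x, ((lam ν * cosProd ν x : ℝ) : ℂ) * expProd n x ∂cubeMeasure m =
        if ∀ j, |n j| = 2 ^ ν j then (lam ν / 2 ^ m : ℂ) else 0 := fun ν => by
      simp_rw [Complex.ofReal_mul, mul_assoc]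
      rw [integral_const_mul, integral_cosProd_mul_expProd, mul_ite, mul_zero, mul_one_div]
    simp_rw [h2] at h1
    by_cases hn : ∃ ν : Fin m → ℕ, ∀ j, |n j| = 2 ^ ν j
    · obtain ⟨ν₀, hν₀⟩ := hn
      have h3 := hasSum_single (f := fun ν : Fin m → ℕ =>
        if ∀ j, |n j| = 2 ^ ν j then (lam ν / 2 ^ m : ℂ) else 0) ν₀ fun ν hν => by
          refine if_neg fun h => hν ?_
          funext j
          have := (h j).symm.trans (hν₀ j)
          exact Nat.pow_right_injective le_rfl (by exact_mod_cast this)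
      rw [h1.unique h3, if_pos hν₀, hf.coeff_eq ν₀ n hν₀]
    · rw [hf.coeff_eq_zero n hn]
      have h3 : (fun ν : Fin m → ℕ => if ∀ j, |n j| = 2 ^ ν j then (lam ν / 2 ^ m : ℂ) else 0) =
          fun _ => 0 := funext fun ν => if_neg fun h => hn ⟨ν, h⟩
      rw [h3] at h1
      exact h1.unique hasSum_zero
  have hae : rescale f =ᵐ[cubeMeasure m] g := by
    have h := ae_eq_zero_of_integral_mul_expProd (hi.sub hgi) fun n => by
      simp_rw [Pi.sub_apply, Complex.ofReal_sub, sub_mul]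
      rw [integral_sub (integrable_mul_expProd hi n) (integrable_mul_expProd hgi n), hcoeff,
        ← coeff_eq_integral_expProd, sub_self]
    filter_upwards [h] with x hx
    exact sub_eq_zero.1 hx
  rwa [eLpNorm_congr_ae hae]

/-- The square sum of lacunary coefficients is controlled by any `L^r` norm with `r` conjugate to an
even integer. -/
theorem HasLacunarySeries.tsum_sq_le {m k : ℕ} (hk : k ≠ 0) {f : (Fin m → ℝ) → ℝ}
    {lam : (Fin m → ℕ) → ℝ} (hf : HasLacunarySeries f lam) {r : ℝ≥0∞}
    (hr : r.HolderConjugate (2 * k : ℕ)) (hfr : MemLp (rescale f) r (cubeMeasure m)) :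
    (∑' ν, ‖lam ν‖ₑ ^ 2) ^ (1 / 2 : ℝ) ≤
      2 ^ m * cubeConst m k ^ (1 / 2 : ℝ) * eLpNorm (rescale f) r (cubeMeasure m) := by
  have hi : Integrable (rescale f) (cubeMeasure m) := hfr.integrable hr.one_le
  have key : ∀ s : Finset (Fin m → ℕ), ∑ ν ∈ s, ‖lam ν‖ₑ ^ 2 ≤
      (2 ^ m * cubeConst m k ^ (1 / 2 : ℝ) * eLpNorm (rescale f) r (cubeMeasure m)) ^ 2 := by
    intro s
    set S := ∑ ν ∈ s, ‖lam ν‖ₑ ^ 2 with hS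
    -- Testing `f` against this partial sum produces the square sum `S` itself, while Hölder and
    -- Khintchine bound the pairing by a multiple of `S ^ (1/2)`.
    set h : (Fin m → ℝ) → ℝ := fun x => ∑ ν ∈ s, lam ν * cosProd ν x with hh
    have e1 : ∫ x, rescale f x * h x ∂cubeMeasure m = (∑ ν ∈ s, lam ν ^ 2) / 2 ^ m := by
      simp_rw [hh, Finset.mul_sum]
      rw [integral_finsetSum s, Finset.sum_div]
      · refine Finset.sum_congr rfl fun ν _ => ?_
        simp_rw [mul_left_comm (rescale f _)]
        rw [integral_const_mul, hf.integral_mul_cosProd hi]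
        ring
      · intro ν _
        refine hi.mul_bdd (c := |lam ν|) (by fun_prop) (Filter.Eventually.of_forall fun x => ?_)
        rw [norm_mul, Real.norm_eq_abs, Real.norm_eq_abs]
        exact mul_le_of_le_one_right (abs_nonneg _) (abs_cosProd_le_one ν x)
    have e2 : S = 2 ^ m * ‖∫ x, rescale f x * h x ∂cubeMeasure m‖ₑ := by
      rw [e1, Real.enorm_of_nonneg (div_nonneg (Finset.sum_nonneg fun _ _ => sq_nonneg _)
        (by positivity)), ENNReal.ofReal_div_of_pos (by positivity),
        ENNReal.ofReal_sum_of_nonneg fun _ _ => sq_nonneg _, ENNReal.ofReal_pow zero_le_two,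
        ENNReal.ofReal_ofNat, ENNReal.mul_div_cancel (by positivity) (by finiteness), hS]
      refine Finset.sum_congr rfl fun ν _ => ?_
      rw [Real.enorm_eq_ofReal_abs, ← ENNReal.ofReal_pow (abs_nonneg _), sq_abs]
    have e3 : ‖∫ x, rescale f x * h x ∂cubeMeasure m‖ₑ ≤
        eLpNorm (rescale f) r (cubeMeasure m) * (cubeConst m k * S) ^ (1 / 2 : ℝ) := by
      refine (enorm_integral_le_lintegral_enorm _).trans ?_
      rw [← eLpNorm_one_eq_lintegral_enorm]
      refine (eLpNorm_smul_le_mul_eLpNorm (p := r) (q := (2 * k : ℕ)) (r := 1) (f := h)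
        (φ := rescale f) (by fun_prop) hfr.1).trans ?_
      gcongr
      exact eLpNorm_sum_cosProd_le hk s lam
    have hSfin : S ≠ ∞ := ENNReal.sum_ne_top.2 fun ν _ => by finiteness
    -- Cancelling `S ^ (1/2)` requires `S` to be neither zero nor infinite.
    rcases eq_or_ne S 0 with h0 | h0
    · rw [h0]; exact zero_le
    have e4 : S ≤ (2 ^ m * cubeConst m k ^ (1 / 2 : ℝ) *
        eLpNorm (rescale f) r (cubeMeasure m)) * S ^ (1 / 2 : ℝ) := by
      refine e2.le.trans ((mul_le_mul_right e3 _).trans_eq ?_)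
      rw [ENNReal.mul_rpow_of_nonneg _ _ (by positivity)]
      ring
    have hroot : S = S ^ (1 / 2 : ℝ) * S ^ (1 / 2 : ℝ) := by
      rw [← ENNReal.rpow_add _ _ h0 hSfin]; norm_num
    have h5 : S ^ (1 / 2 : ℝ) ≤ 2 ^ m * cubeConst m k ^ (1 / 2 : ℝ) *
        eLpNorm (rescale f) r (cubeMeasure m) := by
      rw [← ENNReal.mul_le_mul_iff_left (c := S ^ (1 / 2 : ℝ))]
      · rwa [← hroot]
      · simp [h0]
      · exact ENNReal.rpow_ne_top_of_nonneg (by positivity) hSfin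
    calc S = (S ^ (1 / 2 : ℝ)) ^ 2 := by rw [sq, ← hroot]
      _ ≤ _ := by gcongr
  rw [one_div, ENNReal.rpow_inv_le_iff two_pos, ENNReal.rpow_two]
  rw [ENNReal.tsum_eq_iSup_sum, ← one_div]
  exact iSup_le key

/-! ### Embeddings between Lorentz and Lebesgue spaces on the cube. -/

theorem aemeasurable_rescale {m : ℕ} {f : (Fin m → ℝ) → ℝ} (hf : AEMeasurable f volume) :
    AEMeasurable (rescale f) (cubeMeasure m) := by
  have hq : Measure.QuasiMeasurePreserving (fun x : Fin m → ℝ => (2 * Real.pi) • x)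
      volume volume := by
    refine ⟨measurable_const_smul _, ?_⟩
    rw [Measure.map_addHaar_smul _ (by positivity)]
    exact Measure.smul_absolutelyContinuous
  exact (hf.comp_quasiMeasurePreserving hq).restrict

theorem volume_superlevel_eq {m : ℕ} (f : (Fin m → ℝ) → ℝ) (y : ℝ≥0∞) :
    volume {x | x ∈ unitCube m ∧ y < ‖rescale f x‖ₑ} =
      cubeMeasure m {x | y < ‖rescale f x‖ₑ} := by
  rw [Measure.restrict_apply' (measurableSet_unitCube m), Set.inter_comm]
  rfl

theorem lintegral_Ioo_rpow {a t : ℝ} (ha : 0 < a) (ht : 0 ≤ t) :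
    ∫⁻ s in Set.Ioo 0 t, ENNReal.ofReal (s ^ (a - 1)) = ENNReal.ofReal (t ^ a / a) := by
  rw [← ofReal_integral_eq_lintegral_ofReal, ← integral_Ioc_eq_integral_Ioo,
    ← intervalIntegral.integral_of_le ht, integral_rpow (Or.inl (by linarith))]
  · simp [Real.zero_rpow ha.ne']
  · rcases ht.eq_or_lt with h | h
    · simp [← h]
    · exact (intervalIntegral.integrableOn_Ioo_rpow_iff h).2 (by linarith)
  · filter_upwards [ae_restrict_mem measurableSet_Ioo] with s hs using Real.rpow_nonneg hs.1.le _

theorem lintegral_Ioi_rpow {a c : ℝ} (ha : 0 < a) (hc : 0 < c) :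
    ∫⁻ s in Set.Ioi c, ENNReal.ofReal (s ^ (-a - 1)) = ENNReal.ofReal (c ^ (-a) / a) := by
  rw [← ofReal_integral_eq_lintegral_ofReal, integral_Ioi_rpow_of_lt (by linarith) hc]
  · congr 1
    rw [show -a - 1 + 1 = -a by ring, neg_div_neg_eq]
  · exact integrableOn_Ioi_rpow_of_lt (by linarith) hc
  · filter_upwards [ae_restrict_mem measurableSet_Ioi] with s hs
    exact Real.rpow_nonneg (hc.trans hs).le _

/-- On a probability space, weak `L^p` embeds into `L^r` for `r < p`. -/
theorem lintegral_rpow_le_of_weak {Ω : Type*} [MeasurableSpace Ω] {μ : Measure Ω}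
    [IsProbabilityMeasure μ] {G : Ω → ℝ} (hG : AEMeasurable G μ) {p r W : ℝ} (hr : 0 < r)
    (hrp : r < p) (hW : 0 < W)
    (hweak : ∀ y : ℝ, 0 < y → μ {x | y < |G x|} ≤ ENNReal.ofReal ((W / y) ^ p)) :
    ∫⁻ x, ‖G x‖ₑ ^ r ∂μ ≤ ENNReal.ofReal (p / (p - r) * W ^ r) := by
  have hpr : 0 < p - r := sub_pos.2 hrp
  have e : ∀ x, ‖G x‖ₑ ^ r = ENNReal.ofReal (|G x| ^ r) := fun x => by
    rw [Real.enorm_eq_ofReal_abs, ENNReal.ofReal_rpow_of_nonneg (abs_nonneg _) hr.le]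
  simp_rw [e]
  -- The layer-cake integral is cut at `W`: below it the measure is at most 1, above it the weak
  -- bound is integrable because `r < p`.
  rw [lintegral_rpow_eq_lintegral_meas_lt_mul μ (Filter.Eventually.of_forall fun _ => abs_nonneg _)
    hG.abs hr, ← Set.Ioc_union_Ioi_eq_Ioi hW.le,
    lintegral_union measurableSet_Ioi (Set.Ioc_disjoint_Ioi le_rfl)]
  have h1 : ∫⁻ t in Set.Ioc 0 W, μ {a | t < |G a|} * ENNReal.ofReal (t ^ (r - 1)) ≤
      ENNReal.ofReal (W ^ r / r) := by
    rw [← lintegral_Ioo_rpow hr hW.le, setLIntegral_congr Ioo_ae_eq_Ioc]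
    exact lintegral_mono fun t => mul_le_of_le_one_left' prob_le_one
  have h2 : ∫⁻ t in Set.Ioi W, μ {a | t < |G a|} * ENNReal.ofReal (t ^ (r - 1)) ≤
      ENNReal.ofReal (W ^ r / (p - r)) := by
    calc _ ≤ ∫⁻ t in Set.Ioi W, ENNReal.ofReal (W ^ p) *
          ENNReal.ofReal (t ^ (-(p - r) - 1)) := by
          refine setLIntegral_mono (by fun_prop) fun t ht => ?_
          have ht0 : 0 < t := hW.trans ht
          refine (mul_le_mul_left (hweak t ht0) _).trans_eq ?_
          rw [← ENNReal.ofReal_mul (by positivity), ← ENNReal.ofReal_mul (by positivity)]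
          congr 1
          rw [Real.div_rpow hW.le ht0.le, show -(p - r) - 1 = r - 1 - p by ring,
            Real.rpow_sub ht0 (r - 1) p]
          ring
      _ = _ := by
          rw [lintegral_const_mul _ (by fun_prop), lintegral_Ioi_rpow hpr hW,
            ← ENNReal.ofReal_mul (by positivity), ← mul_div_assoc, ← Real.rpow_add hW]
          congr 3
          ring
  refine (mul_le_mul_right (add_le_add h1 h2) _).trans_eq ?_
  rw [← ENNReal.ofReal_add (by positivity) (by positivity), ← ENNReal.ofReal_mul hr.le]
  congr 1
  field_simp
  ring

/-- The Lorentz quantity controls the distribution function. -/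
theorem measure_superlevel_le {m : ℕ} {p τ : ℝ} (hp : 0 < p) (hτ : 0 < τ)
    {f : (Fin m → ℝ) → ℝ} {V y : ℝ} (hy : 0 < y) (hV : lorentzNorm p τ f ≤ ENNReal.ofReal V)
    (hV0 : 0 < V) :
    cubeMeasure m {x | y < |rescale f x|} ≤
      ENNReal.ofReal (((τ / p) ^ (1 / τ) * V / y) ^ p) := by
  set a := τ / p with ha
  have ha0 : 0 < a := by positivity
  have hset : {x | y < |rescale f x|} = {x | ENNReal.ofReal y < ‖rescale f x‖ₑ} := by
    ext x
    rw [Set.mem_ofPred_eq, Set.mem_ofPred_eq, Real.enorm_eq_ofReal_abs,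
      ENNReal.ofReal_lt_ofReal_iff_of_nonneg hy.le]
  set δ := (cubeMeasure m {x | y < |rescale f x|}).toReal with hδ
  have hδ' : cubeMeasure m {x | y < |rescale f x|} = ENNReal.ofReal δ :=
    (ENNReal.ofReal_toReal (measure_ne_top _ _)).symm
  have hδ0 : 0 ≤ δ := ENNReal.toReal_nonneg
  have hδ1 : δ ≤ 1 := measureReal_le_one
  -- As `δ` is the measure of the superlevel set at `y`, the rearrangement is at least `y` on `(0,
  -- δ)`. Integrating this gives `hint`.
  have hre : ∀ t ∈ Set.Ioo 0 δ, ENNReal.ofReal y ≤ rearrangement f t := by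
    rintro t ⟨h0, ht⟩
    by_contra! hlt
    obtain ⟨z, hz, hzy⟩ := sInf_lt_iff.1 hlt
    rw [Set.mem_ofPred_eq, volume_superlevel_eq] at hz
    have h : ENNReal.ofReal δ ≤ ENNReal.ofReal t := by
      rw [← hδ', hset]
      exact (measure_mono fun x hx => hzy.trans hx).trans hz
    exact absurd ((ENNReal.ofReal_le_ofReal_iff h0.le).1 h) (not_le.2 ht)
  have hint : ENNReal.ofReal (y ^ τ * (δ ^ a / a)) ≤ ENNReal.ofReal (V ^ τ) := by
    rw [← ENNReal.ofReal_rpow_of_nonneg hV0.le hτ.le]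
    rw [lorentzNorm, one_div, ENNReal.rpow_inv_le_iff hτ] at hV
    refine le_trans ?_ hV
    rw [ENNReal.ofReal_mul (by positivity), ← lintegral_Ioo_rpow ha0 hδ0,
      ← ENNReal.ofReal_rpow_of_nonneg hy.le hτ.le, ← lintegral_const_mul _ (by fun_prop)]
    refine le_trans ?_ (lintegral_mono_set (Set.Ioo_subset_Ioo_right hδ1))
    refine setLIntegral_mono' measurableSet_Ioo fun t ht => ?_
    gcongr
    exact hre t ht
  rw [ENNReal.ofReal_le_ofReal_iff (by positivity), ← mul_div_assoc, div_le_iff₀ ha0] at hint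
  rw [hδ']
  refine ENNReal.ofReal_le_ofReal ?_
  have h1 : δ ^ a ≤ a * V ^ τ / y ^ τ := by
    rw [le_div_iff₀ (by positivity)]; linarith
  have h2 : a * V ^ τ / y ^ τ = (a ^ (1 / τ) * V / y) ^ τ := by
    rw [Real.div_rpow (by positivity) hy.le, Real.mul_rpow (by positivity) hV0.le,
      ← Real.rpow_mul ha0.le, one_div, inv_mul_cancel₀ hτ.ne', Real.rpow_one]
  rw [h2] at h1
  have h3 := Real.rpow_le_rpow (by positivity) h1 (z := 1 / a) (by positivity)
  rw [← Real.rpow_mul hδ0, ← Real.rpow_mul (by positivity), mul_one_div_cancel ha0.ne',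
    Real.rpow_one] at h3
  refine h3.trans_eq ?_
  congr 1
  rw [ha]; field_simp

/-- The constant in the embedding of the Lorentz space `L_{p,τ}` into `L^r`, `r < p`. -/
def embeddingConst (p τ r : ℝ) : ℝ := (p / (p - r)) ^ (1 / r) * (τ / p) ^ (1 / τ)

theorem embeddingConst_pos {p τ r : ℝ} (hτ : 0 < τ) (hr : 0 < r) (hrp : r < p) :
    0 < embeddingConst p τ r := by
  have : 0 < p - r := sub_pos.2 hrp
  have : 0 < p := hr.trans hrp
  unfold embeddingConst
  positivity

/-- The Lorentz quantity yields a weak `L^p` bound, which embeds into `L^r` for `r < p`. -/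
theorem eLpNorm_rescale_le {m : ℕ} {p τ r : ℝ} (hτ : 0 < τ) (hr : 0 < r) (hrp : r < p)
    {f : (Fin m → ℝ) → ℝ} (hf : MemLorentz p τ f) :
    eLpNorm (rescale f) (ENNReal.ofReal r) (cubeMeasure m) ≤
      ENNReal.ofReal (embeddingConst p τ r) * lorentzNorm p τ f := by
  have hM := embeddingConst_pos hτ hr hrp
  have hp : 0 < p := hr.trans hrp
  have hpr : 0 < p - r := sub_pos.2 hrp
  rw [mul_comm, ← ENNReal.div_le_iff (by simpa using hM) ENNReal.ofReal_ne_top]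
  -- The weak-type bound needs a positive real majorant, so any larger `V'` replaces the Lorentz
  -- quantity, which may vanish.
  refine le_of_forall_gt_imp_ge_of_dense fun V' hV' => ?_
  rcases eq_or_ne V' ∞ with h | hfin
  · simp [h]
  lift V' to ℝ≥0 using hfin
  have hV0 : (0 : ℝ) < V' := by exact_mod_cast (zero_le.trans_lt hV')
  rw [ENNReal.div_le_iff (by simpa using hM) ENNReal.ofReal_ne_top,
    eLpNorm_eq_lintegral_rpow_enorm_toReal (by simpa using hr) ENNReal.ofReal_ne_top,
    ENNReal.toReal_ofReal hr.le, one_div, ENNReal.rpow_inv_le_iff hr]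
  have hW : 0 < (τ / p) ^ (1 / τ) * V' := by positivity
  refine (lintegral_rpow_le_of_weak (aemeasurable_rescale hf.measurable) hr hrp hW fun y hy =>
    measure_superlevel_le hp hτ hy (by simpa using hV'.le) hV0).trans_eq ?_
  rw [← ENNReal.ofReal_coe_nnreal, ← ENNReal.ofReal_mul hV0.le,
    ENNReal.ofReal_rpow_of_nonneg (by positivity) hr.le]
  congr 1
  rw [embeddingConst, mul_left_comm, Real.mul_rpow (x := (p / (p - r)) ^ (1 / r)) (by positivity)
    (by positivity), ← Real.rpow_mul (by positivity), one_div r, inv_mul_cancel₀ hr.ne',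
    Real.rpow_one, mul_comm (V' : ℝ)]

/-- By Chebyshev's inequality, `|f (2π x)|` exceeds `A t^(-1/q)`, with `A` its `L^q` norm, on a set
of measure at most `t`. -/
theorem rearrangement_le {m : ℕ} {f : (Fin m → ℝ) → ℝ} (hf : AEMeasurable f volume) {q t : ℝ}
    (hq : 0 < q) (ht : 0 < t) :
    rearrangement f t ≤ eLpNorm (rescale f) (ENNReal.ofReal q) (cubeMeasure m) *
      ENNReal.ofReal (t ^ (-(1 / q))) := by
  have hm := (aemeasurable_rescale hf).aestronglyMeasurable
  set A := eLpNorm (rescale f) (ENNReal.ofReal q) (cubeMeasure m) with hA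
  refine sInf_le ?_
  rw [Set.mem_ofPred_eq, volume_superlevel_eq]
  have hs : 0 < t ^ (-(1 / q)) := by positivity
  rcases eq_or_ne A ∞ with h | hfin
  · rw [h, ENNReal.top_mul (by simpa using hs)]; simp
  rcases eq_or_ne A 0 with h0 | h0
  · have hz := (eLpNorm_eq_zero_iff hm (by simpa using hq)).1 h0
    rw [h0, zero_mul]
    refine (le_of_eq (measure_eq_zero_iff_ae_notMem.2 ?_)).trans zero_le
    filter_upwards [hz] with x hx
    simp [hx]
  · have hsub : {x | A * ENNReal.ofReal (t ^ (-(1 / q))) < ‖rescale f x‖ₑ} ⊆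
        {x | A * ENNReal.ofReal (t ^ (-(1 / q))) ≤ ‖rescale f x‖ₑ} :=
      fun x hx => by
        rw [Set.mem_ofPred_eq] at hx ⊢
        exact hx.le
    refine (measure_mono hsub).trans ((meas_ge_le_mul_pow_eLpNorm_enorm
      (p := ENNReal.ofReal q) _ (by simpa using hq) ENNReal.ofReal_ne_top hm
      (mul_ne_zero h0 (ENNReal.ofReal_pos.2 hs).ne') fun h => ?_).trans_eq ?_)
    · exact absurd h (ENNReal.mul_ne_top hfin ENNReal.ofReal_ne_top)
    · rw [ENNReal.toReal_ofReal hq.le, ← ENNReal.mul_rpow_of_nonneg _ _ hq.le, ← hA,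
        ENNReal.mul_inv (Or.inl h0) (Or.inl hfin), mul_right_comm, ENNReal.inv_mul_cancel h0 hfin,
        one_mul, ← ENNReal.ofReal_inv_of_pos hs, ENNReal.ofReal_rpow_of_nonneg (by positivity)
        hq.le, Real.rpow_neg ht.le, inv_inv, ← Real.rpow_mul ht.le, one_div,
        inv_mul_cancel₀ hq.ne', Real.rpow_one]

/-- `L^q` embeds into the Lorentz space `L_{p,τ}` for `p < q`. -/
theorem lorentzNorm_le {m : ℕ} {p τ q : ℝ} (hp : 0 < p) (hτ : 0 < τ) (hpq : p < q)
    {f : (Fin m → ℝ) → ℝ} (hf : AEMeasurable f volume) :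
    lorentzNorm p τ f ≤ ENNReal.ofReal (1 / (τ / p - τ / q)) ^ (1 / τ) *
      eLpNorm (rescale f) (ENNReal.ofReal q) (cubeMeasure m) := by
  have hq : 0 < q := hp.trans hpq
  have ha : 0 < τ / p - τ / q := sub_pos.2 (div_lt_div_of_pos_left hτ hp hpq)
  set A := eLpNorm (rescale f) (ENNReal.ofReal q) (cubeMeasure m) with hA
  rw [lorentzNorm, one_div τ, ENNReal.rpow_inv_le_iff hτ, ENNReal.mul_rpow_of_nonneg _ _ hτ.le,
    ← ENNReal.rpow_mul, inv_mul_cancel₀ hτ.ne', ENNReal.rpow_one, mul_comm]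
  calc _ ≤ ∫⁻ t in Set.Ioo (0 : ℝ) 1, A ^ τ * ENNReal.ofReal (t ^ (τ / p - τ / q - 1)) := by
        refine setLIntegral_mono' measurableSet_Ioo fun t ht => ?_
        refine (mul_le_mul_left (ENNReal.rpow_le_rpow (rearrangement_le hf hq ht.1) hτ.le) _).trans_eq
          ?_
        have ht0 := ht.1
        rw [ENNReal.mul_rpow_of_nonneg _ _ hτ.le, mul_assoc,
          ENNReal.ofReal_rpow_of_nonneg (by positivity) hτ.le, ← ENNReal.ofReal_mul (by positivity),
          ← Real.rpow_mul ht0.le, ← Real.rpow_add ht0]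
        congr 3
        ring
    _ = _ := by
        rw [lintegral_const_mul _ (by fun_prop), lintegral_Ioo_rpow ha zero_le_one, Real.one_rpow]

/-! ### Sequence norms and the two-sided estimate. -/

theorem seqNorm_two {m : ℕ} (lam : (Fin m → ℕ) → ℝ) :
    seqNorm 2 lam = (∑' ν, ‖lam ν‖ₑ ^ 2) ^ (1 / 2 : ℝ) := by
  simp only [seqNorm, ENNReal.rpow_two]

/-- Each coefficient is at most the `ℓ²` norm, so `τ - 2` of the `τ` powers can be bounded by that
norm. -/
theorem seqNorm_le_seqNorm_two {m : ℕ} {τ : ℝ} (hτ : 2 ≤ τ) (lam : (Fin m → ℕ) → ℝ) :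
    seqNorm τ lam ≤ seqNorm 2 lam := by
  have hτ0 : 0 < τ := by linarith
  rw [seqNorm, one_div τ, ENNReal.rpow_inv_le_iff hτ0]
  have hle : ∀ ν, ‖lam ν‖ₑ ≤ seqNorm 2 lam := fun ν => by
    rw [seqNorm, one_div, ENNReal.le_rpow_inv_iff two_pos]
    exact ENNReal.le_tsum ν
  have split : ∀ x : ℝ≥0∞, x ^ τ = x ^ (2 : ℝ) * x ^ (τ - 2) := fun x => by
    rw [← ENNReal.rpow_add_of_nonneg _ _ zero_le_two (by linarith)]
    congr 1; ring
  calc ∑' ν, ‖lam ν‖ₑ ^ τ ≤ ∑' ν, ‖lam ν‖ₑ ^ (2 : ℝ) * seqNorm 2 lam ^ (τ - 2) :=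
        ENNReal.tsum_le_tsum fun ν => by
          rw [split]
          exact mul_le_mul_right (ENNReal.rpow_le_rpow (hle ν) (by linarith)) _
    _ = seqNorm 2 lam ^ (2 : ℝ) * seqNorm 2 lam ^ (τ - 2) := by
        rw [ENNReal.tsum_mul_right]
        congr 1
        rw [seqNorm, ← ENNReal.rpow_mul]
        norm_num
    _ = _ := (split _).symm

/-- For every `p, τ > 1` the Lorentz quantity of a lacunary function dominates the `ℓ²` norm of its
coefficients. -/
theorem exists_seqNorm_two_le (m : ℕ) {p τ : ℝ} (hp : 1 < p) (hτ : 1 < τ) :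
    ∃ C : ℝ≥0, 0 < C ∧ ∀ f ∈ lacunaryClass m p τ, ∀ lam : (Fin m → ℕ) → ℝ,
      HasLacunarySeries f lam → seqNorm 2 lam ≤ C * lorentzNorm p τ f := by
  -- The exponent conjugate to `2k` is below `p` exactly when `2k > p / (p - 1)`.
  obtain ⟨k, hk⟩ := exists_nat_gt (p / (p - 1))
  have hp1 : 0 < p - 1 := by linarith
  have hk1 : (1 : ℝ) < k := lt_trans ((one_lt_div hp1).2 (by linarith)) hk
  have hk0 : k ≠ 0 := by rintro rfl; norm_num at hk1
  set r : ℝ := Real.conjExponent (2 * k) with hr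
  have hconj : (2 * k : ℝ).HolderConjugate r := Real.HolderConjugate.conjExponent (by linarith)
  have hr1 : 1 < r := hconj.symm.lt
  have hrp : r < p := by
    rw [hr, Real.conjExponent, div_lt_iff₀ (by linarith)]
    rw [div_lt_iff₀ hp1] at hk
    nlinarith
  have hr0 : 0 < r := by linarith
  have hτ0 : 0 < τ := by linarith
  have hconj' : (ENNReal.ofReal r).HolderConjugate ((2 * k : ℕ) : ℝ≥0∞) := by
    have h := hconj.symm.ennrealOfReal
    rwa [show (2 * k : ℝ) = ((2 * k : ℕ) : ℝ) by push_cast; rfl, ENNReal.ofReal_natCast] at h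
  refine ⟨2 ^ m * cubeConst m k ^ (1 / 2 : ℝ) * Real.toNNReal (embeddingConst p τ r), ?_, ?_⟩
  · exact mul_pos (mul_pos (by positivity) (NNReal.rpow_pos (cubeConst_pos m k)))
      (Real.toNNReal_pos.2 (embeddingConst_pos hτ0 hr0 hrp))
  · rintro f ⟨hf, -⟩ lam hlam
    have he := eLpNorm_rescale_le hτ0 hr0 hrp hf.toMemLorentz
    have hmem : MemLp (rescale f) (ENNReal.ofReal r) (cubeMeasure m) :=
      ⟨(aemeasurable_rescale hf.measurable).aestronglyMeasurable,
        he.trans_lt (ENNReal.mul_lt_top ENNReal.ofReal_lt_top hf.finite)⟩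
    rw [seqNorm_two]
    refine (hlam.tsum_sq_le hk0 hconj' hmem).trans ((mul_le_mul_right he _).trans_eq ?_)
    rw [← mul_assoc]
    push_cast
    rw [← ENNReal.coe_rpow_of_nonneg _ (by positivity : (0 : ℝ) ≤ 1 / 2)]
    rfl

/-- For every `p, τ > 1` the Lorentz quantity of a lacunary function is dominated by the `ℓ²` norm
of its coefficients. -/
theorem exists_lorentzNorm_le (m : ℕ) {p τ : ℝ} (hp : 1 < p) (hτ : 1 < τ) :
    ∃ C : ℝ≥0, 0 < C ∧ ∀ f ∈ lacunaryClass m p τ, ∀ lam : (Fin m → ℕ) → ℝ,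
      HasLacunarySeries f lam → lorentzNorm p τ f ≤ C * seqNorm 2 lam := by
  obtain ⟨k, hk⟩ := exists_nat_gt p
  have hk0 : k ≠ 0 := by rintro rfl; norm_num at hk; linarith
  have hp0 : 0 < p := by linarith
  have hτ0 : 0 < τ := by linarith
  have hpk : p < (2 * k : ℕ) := by push_cast; linarith
  have ha : 0 < τ / p - τ / (2 * k : ℕ) := sub_pos.2 (div_lt_div_of_pos_left hτ0 hp0 hpk)
  have hC : 0 < Real.toNNReal (1 / (τ / p - τ / (2 * k : ℕ))) ^ (1 / τ) *
      cubeConst m k ^ (1 / 2 : ℝ) :=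
    mul_pos (NNReal.rpow_pos (Real.toNNReal_pos.2 (by positivity)))
      (NNReal.rpow_pos (cubeConst_pos m k))
  refine ⟨_, hC, ?_⟩
  rintro f ⟨hf, -⟩ lam hlam
  -- The midpoint of 1 and `p` is an exponent at least 1 and below `p`, which yields integrability.
  have hr0 : 0 < (1 + p) / 2 := by linarith
  have hmem : MemLp (rescale f) (ENNReal.ofReal ((1 + p) / 2)) (cubeMeasure m) :=
    ⟨(aemeasurable_rescale hf.measurable).aestronglyMeasurable,
      (eLpNorm_rescale_le hτ0 hr0 (by linarith) hf.toMemLorentz).trans_lt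
        (ENNReal.mul_lt_top ENNReal.ofReal_lt_top hf.finite)⟩
  have hi : Integrable (rescale f) (cubeMeasure m) :=
    hmem.integrable (ENNReal.one_le_ofReal.2 (by linarith))
  rw [seqNorm_two]
  -- If the square sum diverges, the right side is infinite because the constant is nonzero.
  rcases eq_or_ne (∑' ν, ‖lam ν‖ₑ ^ 2) ∞ with htop | hfin
  · rw [htop, ENNReal.top_rpow_of_pos (by positivity), ENNReal.mul_top (by exact_mod_cast hC.ne')]
    exact le_top
  · refine (lorentzNorm_le hp0 hτ0 hpk hf.measurable).trans ?_
    rw [ENNReal.ofReal_natCast]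
    refine (mul_le_mul_right (hlam.eLpNorm_le hk0 hi hfin) _).trans_eq ?_
    rw [ENNReal.mul_rpow_of_nonneg _ _ (by positivity), ← mul_assoc, ENNReal.coe_mul,
      ENNReal.coe_rpow_of_nonneg _ (by positivity), ENNReal.coe_rpow_of_nonneg _ (by positivity)]
    rfl

end LorentzLacunary

end

theorem theorem3p1 (m : ℕ) (hm : 1 ≤ m) (p τ : ℝ) (hp : 1 < p) (hτ : 1 < τ) :
    (∃ C : ℝ≥0, 0 < C ∧ ∀ f ∈ LorentzLacunary.lacunaryClass m p τ,
      ∀ lam : (Fin m → ℕ) → ℝ, LorentzLacunary.HasLacunarySeries f lam →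
        LorentzLacunary.lorentzNorm p τ f ≤ C * LorentzLacunary.seqNorm 2 lam) ∧
    ((p ≤ 2 ∧ τ ≤ 2) ∨ 2 < p →
      ∃ C : ℝ≥0, 0 < C ∧ ∀ f ∈ LorentzLacunary.lacunaryClass m p τ,
        ∀ lam : (Fin m → ℕ) → ℝ, LorentzLacunary.HasLacunarySeries f lam →
          LorentzLacunary.seqNorm 2 lam ≤ C * LorentzLacunary.lorentzNorm p τ f) ∧
    (p ≤ 2 ∧ 2 < τ →
      ∃ C : ℝ≥0, 0 < C ∧ ∀ f ∈ LorentzLacunary.lacunaryClass m p τ,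
        ∀ lam : (Fin m → ℕ) → ℝ, LorentzLacunary.HasLacunarySeries f lam →
          LorentzLacunary.seqNorm τ lam ≤ C * LorentzLacunary.lorentzNorm p τ f) := by
  obtain ⟨C, hC, h⟩ := LorentzLacunary.exists_seqNorm_two_le m hp hτ
  exact ⟨LorentzLacunary.exists_lorentzNorm_le m hp hτ, fun _ => ⟨C, hC, h⟩, fun hτ2 =>
    ⟨C, hC, fun f hf lam hlam =>
      (LorentzLacunary.seqNorm_le_seqNorm_two hτ2.2.le lam).trans (h f hf lam hlam)⟩⟩
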